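/- Conventions. A partial commutative monoid (PCM) is a set with an element $0$ and a partial operation $\ovee$ that is commutative, associative and has unit $0$ (in the usual partial sense); $a \perp b$ means that $a \ovee b$ is defined, and $a \le b$ means $a \ovee c = b$ for some $c$. An effect algebra is a PCM with an element $1$ such that every $a$ has a unique $a^\perp$ with $a \ovee a^\perp = 1$, and $a \perp 1$ implies $a = 0$. An effectus (in partial form) is a category $C$ with finite coproducts, enriched in PCMs (composition preserves $\perp$ and $\ovee$ in each argument), such that $[\mathrm{id},0]\circ b \perp [0,\mathrm{id}]\circ b$ for all $b\colon X \to Y+Y$, such that $f \perp g$ implies $\kappa_1 \circ f \perp \kappa_2\circ g$, and with an object $1$ such that: every $\mathrm{Pred}\,X := C(X,1)$ is an effect algebra (with top element also written $1$); $1\circ f \perp 1 \circ g$ implies $f \perp g$; and $1 \circ f = 0$ implies $f = 0$. Elements of $\mathrm{Pred}\,X$ are called predicates on $X$. A quotient for a predicate $p$ on $X$ is a map $\xi\colon X \to Q$ that is universal among the maps out of $X$ with $1 \circ \xi \le p^\perp$ (every $f$ with $1\circ f\le p^\perp$ is $f'\circ\xi$ for a unique $f'$). A comprehension for $p$ is a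 map $\pi\colon K \to X$ that is universal among the maps into $X$ with $p \circ \pi = 1 \circ \pi$ (every $g$ with $p\circ g = 1\circ g$ is $\pi\circ g'$ for a unique $g'$). The image $\mathrm{im}\,f$ of $f\colon X\to Y$ is the least predicate $p$ on $Y$ with $p\circ f = 1 \circ f$. A map is pure if it is $\pi\circ\xi$ for some comprehension $\pi$ and some quotient $\xi$; a predicate is sharp if it is the image of some map; a map $f$ is sharp if $s \circ f$ is sharp for every sharp $s$. A $\diamond$-effectus is an effectus in which all quotients, comprehensions and images exist and $s^\perp$ is sharp for each sharp $s$. In it write $\lfloor p\rfloor = \mathrm{im}\,\pi$ for any comprehension $\pi$ of $p$, $\lceil p\rceil = \lfloor p^\perp\rfloor^\perp$ and, for $f\colon X\to Y$ and sharp $s$ on $Y$, sharp $t$ on $X$, $f^\diamond(s) = \lceil s\circ f\rceil$ and $f_\diamond(t) = \mathrm{im}(f\circ\pi_t)$, where $\pi_t$ is a comprehension of $t$. Maps $f\colon X \to Y$ and $g\colon Y \to X$ are $\diamond$-adjoint if $f^\diamond = g_\diamond$; an endomap is $\diamond$-self-adjoint if it is $\diamond$-adjoint to itself; a pure endomap is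 $\diamond$-positive if it is $g \circ g$ for some $\diamond$-self-adjoint $g$. An $\&$-effectus is a $\diamond$-effectus in which for every predicate $p$ on $X$ there is a unique $\diamond$-positive $\mathrm{asrt}_p\colon X\to X$ with $1\circ \mathrm{asrt}_p = p$, and in which $\xi\circ\pi$ is pure for each quotient $\xi$ and comprehension $\pi$ that are composable. Write $p\mathbin{\&}q = q\circ\mathrm{asrt}_p$. A comprehension $\pi$ of $s$ and a quotient $\zeta$ of $s^\perp$ are called corresponding if $\zeta\circ\pi = \mathrm{id}$ and $\pi\circ\zeta=\mathrm{asrt}_s$. A $\dagger$-category is a category with an involutive identity-on-objects contravariant functor $(\ )^\dagger$; an endomap in it is $\dagger$-positive if it is $g^\dagger\circ g$ for some map $g$. An $\&$-effectus $C$ is a $\dagger$-effectus if the category $\mathrm{Pure}\,C$ of its pure maps carries a $\dagger$-category structure such that (i) $\mathrm{asrt}_p^\dagger = \mathrm{asrt}_p$ for every predicate $p$, and every pure $f$ is $\diamond$-adjoint to $f^\dagger$; (ii) for every $\dagger$-positive $f$ there is a unique $\dagger$-positive $g$ with $g\circ g = f$; (iii) $\diamond$-positive maps are $\dagger$-positive.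 Theorem. Let $C$ be an $\&$-effectus. Then identities are pure and pure maps are closed under composition, so that $\mathrm{Pure}\,C$ is a category, and $C$ is a $\dagger$-effectus if and only if the following three conditions hold: (1) for every predicate $p$ there is a unique predicate $q$ with $q \mathbin{\&} q = p$; (2) $\mathrm{asrt}_{p\mathbin{\&} q}\circ\mathrm{asrt}_{p\mathbin{\&} q} = \mathrm{asrt}_p\circ\mathrm{asrt}_q\circ\mathrm{asrt}_q\circ\mathrm{asrt}_p$ for all predicates $p,q$ on the same object; (3) every quotient for a sharp predicate is a sharp map. Moreover, if (1)-(3) hold, then a dagger that makes $C$ a $\dagger$-effectus is given as follows. For every pure $f$ there exist a comprehension $\pi_1$ of $\mathrm{im}\, f$ with corresponding quotient $\zeta_1$, and a comprehension $\pi_2$ of $\lceil 1\circ f\rceil$ with corresponding quotient $\zeta_2$; for all such choices there is a unique isomorphism $\alpha$ with $f = \pi_1\circ\alpha\circ\zeta_2\circ\mathrm{asrt}_{1\circ f}$; and $$f^\dagger = \mathrm{asrt}_{1\circ f}\circ\pi_2\circ\alpha^{-1}\circ\zeta_1,$$ independently of the choices. In particular this $(\ )^\dagger$ is well defined, involutive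 and contravariantly functorial. -/

import Mathlib

open CategoryTheory CategoryTheory.Limits

universe v u

/-! ### Partial commutative monoids and effect algebras -/

/-- A partial commutative monoid. The partial operation `⊻` is `ovee`, where
`ovee a b = none` means that `a ⊻ b` is undefined. -/
class PCM (M : Type u) where
  zero : M
  ovee : M → M → Option M
  ovee_comm : ∀ a b : M, ovee a b = ovee b a
  ovee_assoc : ∀ {a b c x y : M}, ovee a b = some x → ovee x c = some y →
    ∃ z, ovee b c = some z ∧ ovee a z = some y
  zero_ovee : ∀ a : M, ovee zero a = some a

namespace PCM

variable {M : Type u} [PCM M]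

/-- `a ⊥ b`: the sum of `a` and `b` is defined. -/
def Perp (a b : M) : Prop := ∃ c, ovee a b = some c

/-- The algebraic preorder of a partial commutative monoid. -/
def Le (a b : M) : Prop := ∃ c, ovee a c = some b

end PCM

/-- A partial commutative monoid with distinguished element `one` is an effect algebra. -/
structure IsEffectAlgebra (E : Type u) [PCM E] (one : E) : Prop where
  existsUnique_orthocomplement : ∀ a : E, ∃! b : E, PCM.ovee a b = some one
  eq_zero_of_perp_one : ∀ a : E, PCM.Perp a one → a = PCM.zero

/-! ### Effectuses (in partial form) -/

/-- An effectus in partial form: a finPAC with effects. Composition is written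
diagrammatically: `f ≫ g` is "`g` after `f`". -/
class Effectus (C : Type u) [Category.{v} C] [HasFiniteCoproducts C] where
  /-- enrichment in partial commutative monoids -/
  [homPCM : ∀ X Y : C, PCM (X ⟶ Y)]
  ovee_comp : ∀ {X Y Z : C} {f g k : X ⟶ Y} (h : Y ⟶ Z),
    PCM.ovee f g = some k → PCM.ovee (f ≫ h) (g ≫ h) = some (k ≫ h)
  comp_ovee : ∀ {X Y Z : C} {f g k : Y ⟶ Z} (h : X ⟶ Y),
    PCM.ovee f g = some k → PCM.ovee (h ≫ f) (h ≫ g) = some (h ≫ k)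
  /-- compatible sum axiom; the two maps `Y ⨿ Y ⟶ Y` are the partial projectors -/
  compatible_sum : ∀ {X Y : C} (b : X ⟶ Y ⨿ Y),
    PCM.Perp (b ≫ coprod.desc (𝟙 Y) PCM.zero) (b ≫ coprod.desc PCM.zero (𝟙 Y))
  /-- untying axiom -/
  untying : ∀ {X Y : C} {f g : X ⟶ Y}, PCM.Perp f g →
    PCM.Perp (f ≫ (coprod.inl : Y ⟶ Y ⨿ Y)) (g ≫ (coprod.inr : Y ⟶ Y ⨿ Y))
  /-- the distinguished object, whose maps `X ⟶ I` are the predicates on `X` -/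
  I : C
  /-- the predicate `1` on `X` -/
  truth : ∀ X : C, X ⟶ I
  isEffectAlgebra : ∀ X : C, IsEffectAlgebra (X ⟶ I) (truth X)
  perp_of_truth_perp : ∀ {X Y : C} {f g : X ⟶ Y},
    PCM.Perp (f ≫ truth Y) (g ≫ truth Y) → PCM.Perp f g
  eq_zero_of_truth_eq_zero : ∀ {X Y : C} {f : X ⟶ Y},
    f ≫ truth Y = PCM.zero → f = PCM.zero

attribute [reducible, instance] Effectus.homPCM

namespace Effectus

section Effectus

variable {C : Type u} [Category.{v} C] [HasFiniteCoproducts C] [Effectus C]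

/-- Predicates on `X`. -/
abbrev Pred (X : C) : Type v := X ⟶ (I : C)

/-- The orthocomplement of a predicate. -/
noncomputable def compl {X : C} (p : Pred X) : Pred X :=
  ((isEffectAlgebra X).existsUnique_orthocomplement p).choose

/-- `ξ` is a quotient for the predicate `p`. -/
def IsQuotient {X Q : C} (p : Pred X) (ξ : X ⟶ Q) : Prop :=
  PCM.Le (ξ ≫ truth Q) (compl p) ∧
    ∀ ⦃Y : C⦄ (f : X ⟶ Y), PCM.Le (f ≫ truth Y) (compl p) → ∃! f' : Q ⟶ Y, ξ ≫ f' = f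

/-- `π` is a comprehension for the predicate `p`. -/
def IsComprehension {X K : C} (p : Pred X) (π : K ⟶ X) : Prop :=
  π ≫ p = π ≫ truth X ∧
    ∀ ⦃Z : C⦄ (g : Z ⟶ X), g ≫ p = g ≫ truth X → ∃! g' : Z ⟶ K, g' ≫ π = g

/-- `p` is the image of `f`: the least predicate `p` with `p ∘ f = 1 ∘ f`. -/
def IsImage {X Y : C} (f : X ⟶ Y) (p : Pred Y) : Prop :=
  f ≫ p = f ≫ truth Y ∧ ∀ q : Pred Y, f ≫ q = f ≫ truth Y → PCM.Le p q

/-- A pure map: a comprehension after a quotient. -/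
def IsPure {X Y : C} (f : X ⟶ Y) : Prop :=
  ∃ (Z : C) (ξ : X ⟶ Z) (π : Z ⟶ Y),
    (∃ p : Pred X, IsQuotient p ξ) ∧ (∃ q : Pred Y, IsComprehension q π) ∧ f = ξ ≫ π

variable (C) in
/-- The class of pure maps. -/
def pureMaps : MorphismProperty C := fun _ _ f => IsPure f

/-- A predicate is sharp if it is the image of some map. -/
def IsSharp {X : C} (p : Pred X) : Prop := ∃ (Z : C) (f : Z ⟶ X), IsImage f p

/-- The set of sharp predicates on `X`. -/
abbrev SPred (X : C) : Type v := {p : Pred X // IsSharp p}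

/-- A map is sharp if it pulls back sharp predicates to sharp predicates. -/
def IsSharpMap {X Y : C} (f : X ⟶ Y) : Prop := ∀ s : Pred Y, IsSharp s → IsSharp (f ≫ s)

end Effectus

/-! ### ◇-effectuses -/

/-- A ◇-effectus: an effectus with quotients, comprehension and images in which
orthocomplements of sharp predicates are sharp. -/
class IsDiamondEffectus (C : Type u) [Category.{v} C] [HasFiniteCoproducts C] [Effectus C] :
    Prop where
  exists_quotient : ∀ {X : C} (p : Pred X), ∃ (Q : C) (ξ : X ⟶ Q), IsQuotient p ξ
  exists_comprehension : ∀ {X : C} (p : Pred X), ∃ (K : C) (π : K ⟶ X), IsComprehension p π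
  exists_image : ∀ {X Y : C} (f : X ⟶ Y), ∃ p : Pred Y, IsImage f p
  isSharp_compl : ∀ {X : C} (s : Pred X), IsSharp s → IsSharp (compl s)

section Diamond

variable {C : Type u} [Category.{v} C] [HasFiniteCoproducts C] [Effectus C] [IsDiamondEffectus C]

/-- The domain of a chosen comprehension for `p`. -/
noncomputable def comprObj {X : C} (p : Pred X) : C :=
  (IsDiamondEffectus.exists_comprehension p).choose

/-- A chosen comprehension for `p`. -/
noncomputable def compr {X : C} (p : Pred X) : comprObj p ⟶ X :=
  (IsDiamondEffectus.exists_comprehension p).choose_spec.choose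

/-- The image of a map. -/
noncomputable def im {X Y : C} (f : X ⟶ Y) : Pred Y :=
  (IsDiamondEffectus.exists_image f).choose

theorem isImage_im {X Y : C} (f : X ⟶ Y) : IsImage f (im f) :=
  (IsDiamondEffectus.exists_image f).choose_spec

/-- `⌊p⌋`, the image of a comprehension for `p` (it does not depend on the comprehension). -/
noncomputable def floor {X : C} (p : Pred X) : Pred X := im (compr p)

/-- `⌈p⌉ = ⌊pᗮ⌋ᗮ`. -/
noncomputable def ceil {X : C} (p : Pred X) : Pred X := compl (floor (compl p))

theorem isSharp_im {X Y : C} (f : X ⟶ Y) : IsSharp (im f) := ⟨X, f, isImage_im f⟩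

theorem isSharp_ceil {X : C} (p : Pred X) : IsSharp (ceil p) :=
  IsDiamondEffectus.isSharp_compl _ (isSharp_im _)

/-- `f^◇ (s) = ⌈s ∘ f⌉`. -/
noncomputable def diamondUp {X Y : C} (f : X ⟶ Y) (s : SPred Y) : SPred X :=
  ⟨ceil (f ≫ s.1), isSharp_ceil _⟩

/-- `f_◇ (s) = im (f ∘ π_s)`. -/
noncomputable def diamondDown {X Y : C} (f : X ⟶ Y) (s : SPred X) : SPred Y :=
  ⟨im (compr s.1 ≫ f), isSharp_im _⟩

/-- `f : X ⟶ Y` is ◇-adjoint to `g : Y ⟶ X`. -/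
def IsDiamondAdjoint {X Y : C} (f : X ⟶ Y) (g : Y ⟶ X) : Prop :=
  diamondUp f = diamondDown g

/-- An endomap is ◇-self-adjoint if it is ◇-adjoint to itself. -/
def IsDiamondSelfAdjoint {X : C} (f : X ⟶ X) : Prop := IsDiamondAdjoint f f

/-- A pure endomap is ◇-positive if it is the square of a ◇-self-adjoint map. -/
def IsDiamondPositive {X : C} (f : X ⟶ X) : Prop :=
  IsPure f ∧ ∃ g : X ⟶ X, IsDiamondSelfAdjoint g ∧ f = g ≫ g

end Diamond

/-! ### &-effectuses -/

/-- An &-effectus. -/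
class IsAndEffectus (C : Type u) [Category.{v} C] [HasFiniteCoproducts C] [Effectus C] : Prop
    extends IsDiamondEffectus C where
  existsUnique_asrt : ∀ {X : C} (p : Pred X),
    ∃! f : X ⟶ X, IsDiamondPositive f ∧ f ≫ truth X = p
  isPure_quotient_comprehension : ∀ {X Y Z : C} (π : X ⟶ Y) (ξ : Y ⟶ Z),
    (∃ p : Pred Y, IsComprehension p π) → (∃ q : Pred Y, IsQuotient q ξ) → IsPure (π ≫ ξ)

section And

variable {C : Type u} [Category.{v} C] [HasFiniteCoproducts C] [Effectus C] [IsAndEffectus C]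

/-- `asrt_p`: the unique ◇-positive map with `1 ∘ asrt_p = p`. -/
noncomputable def asrt {X : C} (p : Pred X) : X ⟶ X :=
  (IsAndEffectus.existsUnique_asrt p).choose

theorem isDiamondPositive_asrt {X : C} (p : Pred X) : IsDiamondPositive (asrt p) :=
  (IsAndEffectus.existsUnique_asrt p).choose_spec.1.1

/-- `p & q = q ∘ asrt_p`, pronounced "`p` andthen `q`". -/
noncomputable def andthen {X : C} (p q : Pred X) : Pred X := asrt p ≫ q

/-- For a predicate `s`, `π` is a comprehension of `s` and `ζ` a quotient of `sᗮ`
corresponding to each other: `ζ ∘ π = id` and `π ∘ ζ = asrt_s`. -/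
def IsCorresponding {X A : C} (s : Pred X) (π : A ⟶ X) (ζ : X ⟶ A) : Prop :=
  IsComprehension s π ∧ IsQuotient (compl s) ζ ∧ π ≫ ζ = 𝟙 A ∧ ζ ≫ π = asrt s

/-- The three conditions that characterize †-effectuses among &-effectuses. -/
structure SatisfiesDaggerConditions (C : Type u) [Category.{v} C] [HasFiniteCoproducts C]
    [Effectus C] [IsAndEffectus C] : Prop where
  /-- every predicate has a unique square root -/
  existsUnique_sqrt : ∀ {X : C} (p : Pred X), ∃! q : Pred X, andthen q q = p
  /-- `asrt²_{p & q} = asrt_p ∘ asrt²_q ∘ asrt_p` -/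
  asrt_andthen_sq : ∀ {X : C} (p q : Pred X),
    asrt (andthen p q) ≫ asrt (andthen p q) = asrt p ≫ (asrt q ≫ asrt q) ≫ asrt p
  /-- quotients of sharp predicates are sharp maps -/
  isSharpMap_quotient : ∀ {X Q : C} (s : Pred X) (ξ : X ⟶ Q),
    IsSharp s → IsQuotient s ξ → IsSharpMap ξ

/-- `g` is the value at `f` of the explicit dagger. There are corresponding pairs for `im f`
and `⌈1 ∘ f⌉` and, for *all* such pairs `π₁, ζ₁` and `π₂, ζ₂`, there is a unique isomorphism
`α` with `f = π₁ ∘ α ∘ ζ₂ ∘ asrt_{1 ∘ f}`, and it satisfies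
`g = asrt_{1 ∘ f} ∘ π₂ ∘ α⁻¹ ∘ ζ₁`. -/
def IsStandardDagger {X Y : C} (f : X ⟶ Y) (g : Y ⟶ X) : Prop :=
  (∃ (A : C) (π₁ : A ⟶ Y) (ζ₁ : Y ⟶ A), IsCorresponding (im f) π₁ ζ₁) ∧
  (∃ (B : C) (π₂ : B ⟶ X) (ζ₂ : X ⟶ B), IsCorresponding (ceil (f ≫ truth Y)) π₂ ζ₂) ∧
  ∀ ⦃A B : C⦄ (π₁ : A ⟶ Y) (ζ₁ : Y ⟶ A) (π₂ : B ⟶ X) (ζ₂ : X ⟶ B),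
    IsCorresponding (im f) π₁ ζ₁ → IsCorresponding (ceil (f ≫ truth Y)) π₂ ζ₂ →
    ∃ α : B ≅ A,
      (f = asrt (f ≫ truth Y) ≫ ζ₂ ≫ α.hom ≫ π₁ ∧
        ∀ β : B ≅ A, f = asrt (f ≫ truth Y) ≫ ζ₂ ≫ β.hom ≫ π₁ → β = α) ∧
      g = ζ₁ ≫ α.inv ≫ π₂ ≫ asrt (f ≫ truth Y)

end And

end Effectus

/-! ### †-categories and †-effectuses -/

/-- A dagger on a category: an involutive identity-on-objects contravariant functor. -/
structure DaggerStructure (D : Type u) [Category.{v} D] where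
  dag : ∀ {X Y : D}, (X ⟶ Y) → (Y ⟶ X)
  dag_comp : ∀ {X Y Z : D} (f : X ⟶ Y) (g : Y ⟶ Z), dag (f ≫ g) = dag g ≫ dag f
  dag_id : ∀ X : D, dag (𝟙 X) = 𝟙 X
  dag_dag : ∀ {X Y : D} (f : X ⟶ Y), dag (dag f) = f

/-- An endomap is †-positive if it is of the form `g† ∘ g`. -/
def DaggerStructure.IsPositive {D : Type u} [Category.{v} D] (d : DaggerStructure D)
    {X : D} (f : X ⟶ X) : Prop :=
  ∃ (Y : D) (g : X ⟶ Y), f = g ≫ d.dag g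

namespace Effectus

section Dagger

variable (C : Type u) [Category.{v} C] [HasFiniteCoproducts C] [Effectus C]

/-- The category `Pure C`: the wide subcategory of pure maps (pure maps being closed under
composition and containing the identities). -/
abbrev PureCat [(pureMaps C).IsMultiplicative] : Type u := WideSubcategory (pureMaps C)

variable [IsAndEffectus C] [(pureMaps C).IsMultiplicative]

variable {C} in
/-- `asrt_p` as a map of `Pure C`. -/
noncomputable def pureAsrt {X : PureCat C} (p : Pred X.obj) : X ⟶ X :=
  ⟨asrt p, (isDiamondPositive_asrt p).1⟩

variable {C} in
/-- The dagger `d` on `Pure C` makes the &-effectus `C` a †-effectus. -/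
structure IsEffectusDagger (d : DaggerStructure (PureCat C)) : Prop where
  dag_asrt : ∀ {X : PureCat C} (p : Pred X.obj), d.dag (pureAsrt p) = pureAsrt p
  isDiamondAdjoint : ∀ {X Y : PureCat C} (f : X ⟶ Y), IsDiamondAdjoint f.hom (d.dag f).hom
  existsUnique_sqrt : ∀ {X : PureCat C} (f : X ⟶ X), d.IsPositive f →
    ∃! g : X ⟶ X, d.IsPositive g ∧ g ≫ g = f
  isPositive_of_isDiamondPositive : ∀ {X : PureCat C} (f : X ⟶ X),
    IsDiamondPositive f.hom → d.IsPositive f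

/-- The &-effectus `C` is a †-effectus. -/
def IsDaggerEffectus : Prop := ∃ d : DaggerStructure (PureCat C), IsEffectusDagger d

end Dagger

end Effectus

/-! ### Effect algebras -/

namespace PCM

variable {M : Type u} [PCM M]

/-! Everything reduces to an algebraic description of the dagger that mentions no choices. In an
&-effectus each pure `f` has a polar decomposition `π ∘ ζ ∘ asrt_{1∘f}`, with `ζ` a quotient
corresponding to a comprehension `ρ` of `⌈1∘f⌉` and `π` a comprehension of `im f` with corresponding
quotient `η`. Since `ζ ∘ asrt_{1∘f}` is epi and `π` is split by `η`, exactly one `g` satisfies `g ∘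
f = asrt²_{1∘f}` and `1∘g ≤ im f`, namely `asrt_{1∘f} ∘ ρ ∘ η`. This is `IsPolarAdjoint`; it gives
the explicit formula and its independence of choices at once.

If condition (2) holds, it extends from asserts to all pure maps: `g ∘ asrt²_q ∘ f = asrt²_{q∘f}`
(`IsPolarAdjoint.comp_asrt_sq_comp`). Involutivity and functoriality of the polar adjoint follow by
uniqueness. The †-positive maps then turn out to be the asserts, so their square roots are those
supplied by (1).

Conversely, in a †-effectus every `f† ∘ f` is an assert, and the dagger of a quotient is its
corresponding comprehension. Any admissible dagger is therefore the polar adjoint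
(`IsEffectusDagger.isPolarAdjoint`). Taking `f = asrt_q ∘ asrt_p` yields (2), and square roots of
positive maps yield (1). Condition (3) holds in every &-effectus (`IsQuotient.isSharpMap`): pulling
back along a quotient of a sharp predicate is, up to isomorphism, taking an image along a
comprehension. -/

theorem ovee_zero (a : M) : ovee a zero = some a := by
  rw [ovee_comm, zero_ovee]

theorem Le.refl (a : M) : Le a a := ⟨zero, ovee_zero a⟩

theorem Le.trans {a b c : M} : Le a b → Le b c → Le a c := by
  rintro ⟨x, hx⟩ ⟨y, hy⟩
  obtain ⟨z, -, hz⟩ := ovee_assoc hx hy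
  exact ⟨z, hz⟩

end PCM

namespace IsEffectAlgebra

variable {E : Type u} [PCM E] {one : E}

/-- Adding the orthocomplement of the common sum `x` makes `b` and `c` orthocomplements of one and
the same element. -/
theorem cancel_left (h : IsEffectAlgebra E one) {a b c x : E}
    (hb : PCM.ovee a b = some x) (hc : PCM.ovee a c = some x) : b = c := by
  obtain ⟨d, hd, -⟩ := h.existsUnique_orthocomplement x
  rw [PCM.ovee_comm] at hb hc
  obtain ⟨z, hz, hbz⟩ := PCM.ovee_assoc hb hd
  obtain ⟨z', hz', hcz⟩ := PCM.ovee_assoc hc hd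
  obtain rfl : z = z' := Option.some.inj (hz.symm.trans hz')
  rw [PCM.ovee_comm] at hbz hcz
  exact (h.existsUnique_orthocomplement z).unique hbz hcz

theorem eq_zero_of_ovee_eq_zero (h : IsEffectAlgebra E one) {a b : E}
    (hab : PCM.ovee a b = some PCM.zero) : b = PCM.zero := by
  obtain ⟨z, hz, -⟩ := PCM.ovee_assoc hab (PCM.zero_ovee one)
  exact h.eq_zero_of_perp_one b ⟨z, hz⟩

theorem le_antisymm (h : IsEffectAlgebra E one) {a b : E}
    (hab : PCM.Le a b) (hba : PCM.Le b a) : a = b := by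
  obtain ⟨c, hc⟩ := hab
  obtain ⟨d, hd⟩ := hba
  obtain ⟨z, hz, haz⟩ := PCM.ovee_assoc hc hd
  obtain rfl := h.cancel_left haz (PCM.ovee_zero a)
  rw [PCM.ovee_comm] at hz
  obtain rfl := h.eq_zero_of_ovee_eq_zero hz
  rw [PCM.ovee_zero] at hc
  exact Option.some.inj hc

theorem le_one (h : IsEffectAlgebra E one) (a : E) : PCM.Le a one :=
  let ⟨b, hb, _⟩ := h.existsUnique_orthocomplement a
  ⟨b, hb⟩

end IsEffectAlgebra

namespace Effectus

/-! ### Predicates and composition -/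

section Effectus

variable {C : Type u} [Category.{v} C] [HasFiniteCoproducts C] [Effectus C]

/-- The algebraic order on predicates. -/
instance predPartialOrder {X : C} : PartialOrder (X ⟶ (I : C)) where
  le := PCM.Le
  le_refl := PCM.Le.refl
  le_trans _ _ _ := PCM.Le.trans
  le_antisymm _ _ := (isEffectAlgebra X).le_antisymm

theorem le_truth {X : C} (p : Pred X) : p ≤ truth X := (isEffectAlgebra X).le_one p

theorem ovee_compl {X : C} (p : Pred X) : PCM.ovee p (compl p) = some (truth X) :=
  ((isEffectAlgebra X).existsUnique_orthocomplement p).choose_spec.1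

theorem eq_compl {X : C} {p q : Pred X} (h : PCM.ovee p q = some (truth X)) : q = compl p :=
  (isEffectAlgebra X).cancel_left h (ovee_compl p)

@[simp]
theorem compl_compl {X : C} (p : Pred X) : compl (compl p) = p :=
  (eq_compl (by rw [PCM.ovee_comm, ovee_compl])).symm

theorem compl_le_compl {X : C} {p q : Pred X} (h : p ≤ q) : compl q ≤ compl p := by
  obtain ⟨c, hc⟩ := h
  obtain ⟨z, hz, hpz⟩ := PCM.ovee_assoc hc (ovee_compl q)
  rw [eq_compl hpz, PCM.ovee_comm] at hz
  exact ⟨c, hz⟩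

theorem compl_le_compl_iff {X : C} {p q : Pred X} : compl q ≤ compl p ↔ p ≤ q :=
  ⟨fun h => by simpa using compl_le_compl h, compl_le_compl⟩

theorem compl_le_iff {X : C} {p q : Pred X} : compl p ≤ q ↔ compl q ≤ p := by
  rw [← compl_le_compl_iff, compl_compl]

theorem le_compl_iff {X : C} {p q : Pred X} : p ≤ compl q ↔ q ≤ compl p := by
  rw [← compl_le_compl_iff, compl_compl]

theorem eq_zero_of_ovee_self {X : C} {p : Pred X} (h : PCM.ovee p p = some p) : p = PCM.zero :=
  (isEffectAlgebra X).cancel_left h (PCM.ovee_zero p)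

theorem zero_comp {X Y Z : C} (f : Y ⟶ Z) : (PCM.zero : X ⟶ Y) ≫ f = PCM.zero := by
  apply eq_zero_of_truth_eq_zero
  rw [Category.assoc]
  exact eq_zero_of_ovee_self (ovee_comp _ (PCM.zero_ovee _))

theorem comp_zero {X Y Z : C} (f : X ⟶ Y) : f ≫ (PCM.zero : Y ⟶ Z) = PCM.zero := by
  apply eq_zero_of_truth_eq_zero
  rw [Category.assoc, zero_comp]
  exact eq_zero_of_ovee_self (comp_ovee _ (PCM.zero_ovee _))

theorem comp_le_comp {X Y : C} (f : X ⟶ Y) {p q : Pred Y} (h : p ≤ q) : f ≫ p ≤ f ≫ q := by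
  obtain ⟨c, hc⟩ := h
  exact ⟨f ≫ c, comp_ovee f hc⟩

theorem comp_le_truth {X Y : C} (f : X ⟶ Y) (p : Pred Y) : f ≫ p ≤ f ≫ truth Y :=
  comp_le_comp f (le_truth p)

variable (C) in
-- If `id ⊻ c = 1`, following by `1` puts `1 ∘ c` orthogonal to truth, so `c` vanishes.
theorem truth_I : truth (I : C) = 𝟙 (I : C) := by
  obtain ⟨c, hc⟩ := le_truth (𝟙 (I : C))
  have h := ovee_comp (truth (I : C)) hc
  rw [Category.id_comp, PCM.ovee_comm] at h
  have hz := eq_zero_of_truth_eq_zero ((isEffectAlgebra _).eq_zero_of_perp_one _ ⟨_, h⟩)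
  rw [hz, PCM.ovee_zero] at hc
  exact (Option.some.inj hc).symm

@[simp]
theorem pred_comp_truth {X : C} (p : Pred X) : p ≫ truth I = p := by
  rw [truth_I, Category.comp_id]

theorem ovee_comp_compl {X Y : C} (f : X ⟶ Y) (p : Pred Y) :
    PCM.ovee (f ≫ p) (f ≫ compl p) = some (f ≫ truth Y) := comp_ovee f (ovee_compl p)

theorem comp_compl_eq_zero_iff {X Y : C} (f : X ⟶ Y) (p : Pred Y) :
    f ≫ compl p = PCM.zero ↔ f ≫ p = f ≫ truth Y := by
  have h := ovee_comp_compl f p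
  constructor
  · intro hz
    rw [hz, PCM.ovee_zero] at h
    exact Option.some.inj h
  · intro he
    rw [he] at h
    exact (isEffectAlgebra X).cancel_left h (PCM.ovee_zero _)

theorem comp_eq_truth_mono {X Y : C} {f : X ⟶ Y} {p q : Pred Y} (h : p ≤ q)
    (hp : f ≫ p = f ≫ truth Y) : f ≫ q = f ≫ truth Y :=
  _root_.le_antisymm (comp_le_truth f q) (hp ▸ comp_le_comp f h)

/-! ### Quotients -/

/-- A map is a quotient for some predicate. -/
def IsQuot {X Q : C} (ξ : X ⟶ Q) : Prop := ∃ p : Pred X, IsQuotient p ξ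

/-- A map is a comprehension for some predicate. -/
def IsCompr {K X : C} (π : K ⟶ X) : Prop := ∃ p : Pred X, IsComprehension p π

theorem IsQuotient.comp_truth {X Q : C} {p : Pred X} {ξ : X ⟶ Q} (h : IsQuotient p ξ) :
    ξ ≫ truth Q = compl p := by
  refine _root_.le_antisymm h.1 ?_
  obtain ⟨q, hq, -⟩ := h.2 (compl p) (by rw [pred_comp_truth]; exact PCM.Le.refl _)
  rw [← hq]
  exact comp_le_truth ξ q

theorem IsQuotient.epi {X Q : C} {p : Pred X} {ξ : X ⟶ Q} (h : IsQuotient p ξ) : Epi ξ where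
  left_cancellation {Y} f g hfg := by
    refine (h.2 (ξ ≫ f) ?_).unique rfl hfg.symm
    rw [Category.assoc, ← h.comp_truth]
    exact comp_le_truth ξ _

theorem IsQuot.epi {X Q : C} {ξ : X ⟶ Q} (h : IsQuot ξ) : Epi ξ := h.choose_spec.epi

theorem IsQuot.exists_fac {X Q Y : C} {ξ : X ⟶ Q} (h : IsQuot ξ) (f : X ⟶ Y)
    (hf : f ≫ truth Y ≤ ξ ≫ truth Q) : ∃ f' : Q ⟶ Y, ξ ≫ f' = f := by
  obtain ⟨p, hp⟩ := h
  rw [hp.comp_truth] at hf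
  exact (hp.2 f hf).exists

theorem isQuotient_iff {X Q : C} {p : Pred X} {ξ : X ⟶ Q} :
    IsQuotient p ξ ↔ ξ ≫ truth Q = compl p ∧ IsQuot ξ := by
  refine ⟨fun h => ⟨h.comp_truth, p, h⟩, fun ⟨h, hξ⟩ => ⟨h ▸ PCM.Le.refl _, fun Y f hf => ?_⟩⟩
  rw [← h] at hf
  obtain ⟨f', hf'⟩ := hξ.exists_fac f hf
  have := hξ.epi
  exact ⟨f', hf', fun g hg => by rwa [← hf', cancel_epi] at hg⟩

theorem isQuot_of_epi_of_fac {X Q : C} {ξ : X ⟶ Q} (he : Epi ξ)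
    (h : ∀ ⦃Y : C⦄ (f : X ⟶ Y), f ≫ truth Y ≤ ξ ≫ truth Q → ∃ f' : Q ⟶ Y, ξ ≫ f' = f) :
    IsQuot ξ := by
  refine ⟨compl (ξ ≫ truth Q), ?_, fun Y f hf => ?_⟩
  · rw [compl_compl]
    exact PCM.Le.refl _
  · rw [compl_compl] at hf
    obtain ⟨f', hf'⟩ := h f hf
    exact ⟨f', hf', fun g hg => by rwa [← hf', cancel_epi] at hg⟩

/-- Precomposition with a quotient reflects the order of predicates. -/
theorem IsQuot.le_of_comp_le_comp {X Q : C} {ξ : X ⟶ Q} (h : IsQuot ξ) {p q : Pred Q}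
    (hpq : ξ ≫ p ≤ ξ ≫ q) : p ≤ q := by
  have := h.epi
  obtain ⟨c, hc⟩ := hpq
  -- The two summands are packed into one map to `I ⨿ I`. It factors through `ξ`, and the compatible
  -- sum axiom then produces orthogonality on `Q`, where no difference of predicates was available.
  obtain ⟨k, hk⟩ := untying ⟨_, hc⟩
  have h₁ := ovee_comp (coprod.desc (𝟙 I) PCM.zero) hk
  have h₂ := ovee_comp (coprod.desc PCM.zero (𝟙 I)) hk
  have h₃ := ovee_comp (coprod.desc (𝟙 I) (𝟙 I)) hk
  simp only [Category.assoc, coprod.inl_desc, coprod.inr_desc, Category.comp_id, comp_zero,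
    PCM.ovee_zero, PCM.zero_ovee, Option.some.injEq] at h₁ h₂ h₃
  have hle : k ≫ truth (I ⨿ I) ≤ ξ ≫ truth Q := by
    -- The complement of the codiagonal vanishes on each summand.
    have ht : truth (I ⨿ I : C) = coprod.desc (𝟙 I) (𝟙 I) := by
      refine _root_.le_antisymm ?_ (le_truth _)
      obtain ⟨c, hc⟩ := le_truth (coprod.desc (𝟙 I) (𝟙 I) : (I ⨿ I : C) ⟶ I)
      have e : c = PCM.zero := by
        apply coprod.hom_ext
        · have := comp_ovee coprod.inl hc
          rw [coprod.inl_desc, ← truth_I, PCM.ovee_comm] at this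
          rw [comp_zero]
          exact (isEffectAlgebra _).eq_zero_of_perp_one _ ⟨_, this⟩
        · have := comp_ovee coprod.inr hc
          rw [coprod.inr_desc, ← truth_I, PCM.ovee_comm] at this
          rw [comp_zero]
          exact (isEffectAlgebra _).eq_zero_of_perp_one _ ⟨_, this⟩
      rw [e, PCM.ovee_zero] at hc
      rw [Option.some.inj hc]
    rw [ht, ← Option.some.inj (hc.symm.trans h₃)]
    exact comp_le_truth ξ q
  obtain ⟨b, rfl⟩ := h.exists_fac k hle
  rw [Category.assoc, cancel_epi] at h₁
  obtain ⟨z, hz⟩ := compatible_sum b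
  have hz' := comp_ovee ξ hz
  rw [← h₁] at hz
  rw [← h₁, ← Category.assoc ξ b, ← h₂, hc, Option.some.injEq, cancel_epi] at hz'
  rw [hz']
  exact ⟨_, hz⟩

theorem IsQuot.comp {X Y Z : C} {ξ : X ⟶ Y} {η : Y ⟶ Z} (hξ : IsQuot ξ) (hη : IsQuot η) :
    IsQuot (ξ ≫ η) := by
  have := hξ.epi
  have := hη.epi
  refine isQuot_of_epi_of_fac (epi_comp ξ η) fun W f hf => ?_
  rw [Category.assoc] at hf
  obtain ⟨f', rfl⟩ := hξ.exists_fac f (hf.trans (comp_le_truth ξ _))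
  rw [Category.assoc] at hf
  obtain ⟨f'', rfl⟩ := hη.exists_fac f' (hξ.le_of_comp_le_comp hf)
  exact ⟨f'', by simp⟩

theorem iso_comp_truth {X Y : C} (α : X ⟶ Y) [IsIso α] : α ≫ truth Y = truth X := by
  refine _root_.le_antisymm (le_truth _) ?_
  calc truth X = α ≫ inv α ≫ truth X := by simp
    _ ≤ α ≫ truth Y := comp_le_truth _ _

theorem isQuot_of_isIso {X Y : C} (α : X ⟶ Y) [IsIso α] : IsQuot α :=
  isQuot_of_epi_of_fac inferInstance fun _ f _ => ⟨inv α ≫ f, by simp⟩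

theorem IsQuot.isIso_of_total {X Q : C} {ξ : X ⟶ Q} (h : IsQuot ξ)
    (ht : ξ ≫ truth Q = truth X) : IsIso ξ := by
  obtain ⟨f, hf⟩ := h.exists_fac (𝟙 X) (by rw [Category.id_comp, ht])
  have := h.epi
  exact ⟨f, hf, by rw [← cancel_epi ξ, reassoc_of% hf, Category.comp_id]⟩

/-- Quotients with the same truth value differ by an isomorphism. -/
theorem IsQuot.exists_iso {X Q R : C} {ξ : X ⟶ Q} {η : X ⟶ R} (hξ : IsQuot ξ) (hη : IsQuot η)
    (h : ξ ≫ truth Q = η ≫ truth R) : ∃ α : Q ≅ R, ξ ≫ α.hom = η := by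
  have := hξ.epi
  have := hη.epi
  obtain ⟨f, hf⟩ := hξ.exists_fac η h.ge
  obtain ⟨g, hg⟩ := hη.exists_fac ξ h.le
  exact ⟨⟨f, g, by rw [← cancel_epi ξ, reassoc_of% hf, hg, Category.comp_id],
    by rw [← cancel_epi η, reassoc_of% hg, hf, Category.comp_id]⟩, hf⟩

/-! ### Comprehensions -/

theorem IsComprehension.mono {X K : C} {p : Pred X} {π : K ⟶ X} (h : IsComprehension p π) :
    Mono π where
  right_cancellation f g hfg :=
    (h.2 (f ≫ π) (by rw [Category.assoc, h.1, Category.assoc])).unique rfl hfg.symm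

theorem IsCompr.mono {X K : C} {π : K ⟶ X} (h : IsCompr π) : Mono π := h.choose_spec.mono

theorem isCompr_of_isIso {X Y : C} (α : X ⟶ Y) [IsIso α] : IsCompr α :=
  ⟨truth Y, rfl, fun _ f _ => ⟨f ≫ inv α, by simp, fun g hg => by simp [← hg]⟩⟩

theorem IsCompr.iso_comp {X K L : C} {π : K ⟶ X} (hπ : IsCompr π) (α : L ⟶ K) [IsIso α] :
    IsCompr (α ≫ π) := by
  obtain ⟨p, hp⟩ := hπ
  refine ⟨p, by simp [hp.1], fun Z g hg => ?_⟩
  obtain ⟨k, hk, hu⟩ := hp.2 g hg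
  exact ⟨k ≫ inv α, by simpa using hk, fun y hy => by simp [← hu (y ≫ α) (by simpa using hy)]⟩

theorem IsQuot.isPure {X Y : C} {f : X ⟶ Y} (h : IsQuot f) : IsPure f :=
  ⟨Y, f, 𝟙 Y, h, isCompr_of_isIso _, by simp⟩

theorem IsCompr.isPure {X Y : C} {f : X ⟶ Y} (h : IsCompr f) : IsPure f :=
  ⟨X, 𝟙 X, f, isQuot_of_isIso _, h, by simp⟩

end Effectus

/-! ### Images, floors, ceilings and the diamond maps -/

section Diamond

variable {C : Type u} [Category.{v} C] [HasFiniteCoproducts C] [Effectus C] [IsDiamondEffectus C]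

theorem isComprehension_compr {X : C} (p : Pred X) : IsComprehension p (compr p) :=
  (IsDiamondEffectus.exists_comprehension p).choose_spec.choose_spec

theorem im_le_iff {X Y : C} (f : X ⟶ Y) (p : Pred Y) : im f ≤ p ↔ f ≫ p = f ≫ truth Y :=
  ⟨fun h => comp_eq_truth_mono h (isImage_im f).1, (isImage_im f).2 p⟩

@[simp]
theorem comp_im {X Y : C} (f : X ⟶ Y) : f ≫ im f = f ≫ truth Y := (isImage_im f).1

theorem comp_eq_zero_iff {X Y : C} (f : X ⟶ Y) (p : Pred Y) :
    f ≫ p = PCM.zero ↔ im f ≤ compl p := by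
  rw [im_le_iff, ← comp_compl_eq_zero_iff, compl_compl]

theorem IsImage.eq_im {X Y : C} {f : X ⟶ Y} {p : Pred Y} (h : IsImage f p) : p = im f :=
  _root_.le_antisymm (h.2 _ (comp_im f)) ((im_le_iff f p).2 h.1)

/-- Images are determined by which predicates they annihilate, and whether `f` annihilates the
pullback of a predicate along `k` depends only on `im f`. -/
theorem im_comp_congr {X X' Y Z : C} {f : X ⟶ Y} {g : X' ⟶ Y} (h : im f = im g) (k : Y ⟶ Z) :
    im (f ≫ k) = im (g ≫ k) := by
  refine eq_of_forall_ge_iff fun p => ?_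
  rw [← compl_compl p, ← comp_eq_zero_iff, ← comp_eq_zero_iff, Category.assoc, Category.assoc,
    comp_eq_zero_iff, comp_eq_zero_iff, h]

theorem im_comp_le {X Y Z : C} (f : X ⟶ Y) (g : Y ⟶ Z) : im (f ≫ g) ≤ im g := by
  rw [im_le_iff, Category.assoc, comp_im, Category.assoc]

theorem im_eq_truth_of_epi {X Y : C} (f : X ⟶ Y) [Epi f] : im f = truth Y :=
  (cancel_epi f).1 (comp_im f)

theorem im_epi_comp {X Y Z : C} (f : X ⟶ Y) [Epi f] (g : Y ⟶ Z) : im (f ≫ g) = im g := by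
  rw [im_comp_congr (g := 𝟙 Y) (by simp [im_eq_truth_of_epi]), Category.id_comp]

theorem isSharp_truth (X : C) : IsSharp (truth X) :=
  im_eq_truth_of_epi (𝟙 X) ▸ isSharp_im _

/-- Factor `π = g ∘ ξ` through a quotient `ξ` with the same truth value. As `ξ` is epi, `g` again
lands in `p`, so `g = π ∘ k` and `k ∘ ξ = id` because `π` is mono. Hence `ξ`, and with it `π`, is
total. -/
theorem IsComprehension.total {X K : C} {p : Pred X} {π : K ⟶ X} (h : IsComprehension p π) :
    π ≫ truth X = truth K := by
  refine _root_.le_antisymm (le_truth _) ?_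
  obtain ⟨Q, ξ, hξ⟩ := IsDiamondEffectus.exists_quotient (compl (π ≫ truth X))
  have := hξ.epi
  have ht := hξ.comp_truth
  rw [compl_compl] at ht
  obtain ⟨g, hg⟩ := IsQuot.exists_fac ⟨_, hξ⟩ π ht.ge
  have hp : g ≫ p = g ≫ truth X := by
    rw [← cancel_epi ξ, reassoc_of% hg, reassoc_of% hg, h.1]
  obtain ⟨k, rfl, -⟩ := h.2 g hp
  have := h.mono
  rw [← Category.assoc] at hg
  have hk : ξ ≫ k = 𝟙 K := by rw [← cancel_mono π, hg, Category.id_comp]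
  rw [← ht, ← Category.id_comp (truth K), ← hk, Category.assoc]
  exact comp_le_truth _ _

theorem IsCompr.total {X K : C} {π : K ⟶ X} (h : IsCompr π) : π ≫ truth X = truth K :=
  h.choose_spec.total

theorem IsComprehension.im_le {X K : C} {p : Pred X} {π : K ⟶ X} (h : IsComprehension p π) :
    im π ≤ p := (im_le_iff _ _).2 h.1

theorem IsCompr.isComprehension_im {X K : C} {π : K ⟶ X} (h : IsCompr π) :
    IsComprehension (im π) π := by
  obtain ⟨p, hp⟩ := h
  exact ⟨comp_im π, fun Z g hg => hp.2 g (comp_eq_truth_mono hp.im_le hg)⟩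

theorem IsComprehension.im_eq {X K : C} {s : Pred X} {π : K ⟶ X} (h : IsComprehension s π)
    (hs : IsSharp s) : im π = s := by
  refine _root_.le_antisymm h.im_le ?_
  obtain ⟨Z, f, hf⟩ := hs
  obtain ⟨g, rfl, -⟩ := h.2 f hf.1
  rw [hf.eq_im]
  exact im_comp_le _ _

theorem IsCompr.exists_fac {X K Z : C} {π : K ⟶ X} (h : IsCompr π) (f : Z ⟶ X)
    (hf : im f ≤ im π) : ∃ f' : Z ⟶ K, f' ≫ π = f :=
  (h.isComprehension_im.2 f ((im_le_iff _ _).1 hf)).exists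

/-- Comprehensions with the same image differ by an isomorphism. -/
theorem IsCompr.exists_iso {X K L : C} {π : K ⟶ X} {ρ : L ⟶ X} (hπ : IsCompr π)
    (hρ : IsCompr ρ) (h : im π = im ρ) : ∃ α : K ≅ L, α.hom ≫ ρ = π := by
  have := hπ.mono
  have := hρ.mono
  obtain ⟨f, hf⟩ := hρ.exists_fac π h.le
  obtain ⟨g, hg⟩ := hπ.exists_fac ρ h.ge
  exact ⟨⟨f, g, by rw [← cancel_mono π, Category.assoc, hg, hf, Category.id_comp],
    by rw [← cancel_mono ρ, Category.assoc, hf, hg, Category.id_comp]⟩, hf⟩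

theorem IsComprehension.of_isCompr {X K : C} {s : Pred X} {π : K ⟶ X} (h : IsCompr π)
    (hs : im π = s) : IsComprehension s π := hs ▸ h.isComprehension_im

theorem IsPure.isCompr_of_total {X Y : C} {f : X ⟶ Y} (hf : IsPure f)
    (ht : f ≫ truth Y = truth X) : IsCompr f := by
  obtain ⟨Z, ξ, π, hξ, hπ, rfl⟩ := hf
  rw [Category.assoc, IsCompr.total hπ] at ht
  have := IsQuot.isIso_of_total hξ ht
  exact IsCompr.iso_comp hπ ξ

theorem im_compr {X : C} {s : Pred X} (hs : IsSharp s) : im (compr s) = s :=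
  (isComprehension_compr s).im_eq hs

/-! ### Floors, ceilings and the Galois connection between the diamond maps. -/

theorem IsSharp.le_floor_iff {X : C} {s : Pred X} (hs : IsSharp s) (p : Pred X) :
    s ≤ floor p ↔ s ≤ p := by
  refine ⟨fun h => h.trans (isComprehension_compr p).im_le, fun h => ?_⟩
  rw [← im_compr hs, im_le_iff] at h
  obtain ⟨g, hg, -⟩ := (isComprehension_compr p).2 _ h
  rw [← im_compr hs, ← hg]
  exact im_comp_le _ _

theorem IsSharp.ceil_le_iff {X : C} {s : Pred X} (hs : IsSharp s) (p : Pred X) :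
    ceil p ≤ s ↔ p ≤ s := by
  rw [ceil, compl_le_iff, (IsDiamondEffectus.isSharp_compl s hs).le_floor_iff, compl_le_compl_iff]

theorem le_ceil {X : C} (p : Pred X) : p ≤ ceil p := ((isSharp_ceil p).ceil_le_iff p).1 le_rfl

theorem IsSharp.ceil_eq {X : C} {s : Pred X} (hs : IsSharp s) : ceil s = s :=
  _root_.le_antisymm ((hs.ceil_le_iff s).2 le_rfl) (le_ceil s)

theorem comp_ceil_eq_zero_iff {X Y : C} (f : X ⟶ Y) (p : Pred Y) :
    f ≫ ceil p = PCM.zero ↔ f ≫ p = PCM.zero := by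
  rw [comp_eq_zero_iff, comp_eq_zero_iff, ceil, compl_compl, (isSharp_im f).le_floor_iff]

theorem isSharp_floor {X : C} (p : Pred X) : IsSharp (floor p) := isSharp_im _

/-- A ceiling is determined by the maps that annihilate the predicate; comprehensions of sharp
predicates suffice as test maps. -/
theorem ceil_congr {X : C} {p q : Pred X}
    (h : ∀ ⦃Z : C⦄ (f : Z ⟶ X), f ≫ p = PCM.zero ↔ f ≫ q = PCM.zero) : ceil p = ceil q := by
  have key : ∀ s : Pred X, IsSharp s → (s ≤ floor (compl p) ↔ s ≤ floor (compl q)) :=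
    fun s hs => by
      rw [hs.le_floor_iff, hs.le_floor_iff, ← im_compr hs, ← comp_eq_zero_iff,
        ← comp_eq_zero_iff, h]
  exact congrArg compl (_root_.le_antisymm ((key _ (isSharp_floor _)).1 le_rfl)
    ((key _ (isSharp_floor _)).2 le_rfl))

theorem diamondUp_comp {X Y Z : C} (f : X ⟶ Y) (g : Y ⟶ Z) (s : SPred Z) :
    diamondUp (f ≫ g) s = diamondUp f (diamondUp g s) := by
  apply Subtype.ext
  refine ceil_congr fun W h => ?_
  change _ ↔ h ≫ f ≫ ceil (g ≫ s.1) = _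
  rw [← Category.assoc h f, comp_ceil_eq_zero_iff]
  simp

theorem diamondDown_comp {X Y Z : C} (f : X ⟶ Y) (g : Y ⟶ Z) (s : SPred X) :
    diamondDown (f ≫ g) s = diamondDown g (diamondDown f s) := by
  apply Subtype.ext
  change im (compr s.1 ≫ f ≫ g) = im (compr (im (compr s.1 ≫ f)) ≫ g)
  rw [← Category.assoc]
  exact im_comp_congr (im_compr (isSharp_im _)).symm g

theorem diamondDown_truth {X Y : C} (f : X ⟶ Y) :
    (diamondDown f ⟨truth X, isSharp_truth X⟩).1 = im f := by
  change im (compr (truth X) ≫ f) = im f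
  rw [im_comp_congr (g := 𝟙 X) _ f, Category.id_comp]
  rw [im_compr (isSharp_truth X), im_eq_truth_of_epi]

/-- Both sides say that `s ∘ f ∘ π_t = 0`. This Galois connection is what makes ◇-adjointness
symmetric. -/
theorem diamondDown_le_compl_iff {X Y : C} (f : X ⟶ Y) (s : SPred Y) (t : SPred X) :
    (diamondDown f t).1 ≤ compl s.1 ↔ (diamondUp f s).1 ≤ compl t.1 := by
  change im (compr t.1 ≫ f) ≤ _ ↔ ceil (f ≫ s.1) ≤ _
  rw [← comp_eq_zero_iff, Category.assoc, ← comp_ceil_eq_zero_iff, comp_eq_zero_iff,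
    im_compr t.2, le_compl_iff]

theorem SPred.ext_le_compl {X : C} {s t : SPred X}
    (h : ∀ r : SPred X, s.1 ≤ compl r.1 ↔ t.1 ≤ compl r.1) : s = t := by
  apply Subtype.ext
  refine _root_.le_antisymm ?_ ?_
  · simpa using (h ⟨_, IsDiamondEffectus.isSharp_compl _ t.2⟩).2 (by simp)
  · simpa using (h ⟨_, IsDiamondEffectus.isSharp_compl _ s.2⟩).1 (by simp)

theorem IsDiamondAdjoint.symm {X Y : C} {f : X ⟶ Y} {g : Y ⟶ X} (h : IsDiamondAdjoint f g) :
    IsDiamondAdjoint g f := by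
  funext t
  refine SPred.ext_le_compl fun s => ?_
  rw [diamondDown_le_compl_iff, ← diamondDown_le_compl_iff, h]

theorem IsDiamondAdjoint.comp {X Y Z : C} {f : X ⟶ Y} {f' : Y ⟶ X} {g : Y ⟶ Z} {g' : Z ⟶ Y}
    (hf : IsDiamondAdjoint f f') (hg : IsDiamondAdjoint g g') :
    IsDiamondAdjoint (f ≫ g) (g' ≫ f') := by
  funext s
  rw [diamondUp_comp, diamondDown_comp, hf, hg]

theorem IsDiamondAdjoint.ceil_comp_truth {X Y : C} {f : X ⟶ Y} {g : Y ⟶ X}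
    (h : IsDiamondAdjoint f g) : ceil (f ≫ truth Y) = im g := by
  rw [← diamondDown_truth, ← h]
  rfl

end Diamond

end Effectus

namespace Effectus

/-! ### Assert maps, corresponding pairs and pure maps -/

section And

variable {C : Type u} [Category.{v} C] [HasFiniteCoproducts C] [Effectus C] [IsAndEffectus C]

@[simp]
theorem asrt_comp_truth {X : C} (p : Pred X) : asrt p ≫ truth X = p :=
  (IsAndEffectus.existsUnique_asrt p).choose_spec.1.2

theorem IsDiamondPositive.eq_asrt {X : C} {f : X ⟶ X} (h : IsDiamondPositive f) {p : Pred X}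
    (hp : f ≫ truth X = p) : f = asrt p :=
  (IsAndEffectus.existsUnique_asrt p).unique ⟨h, hp⟩ ⟨isDiamondPositive_asrt p, asrt_comp_truth p⟩

theorem isPure_asrt {X : C} (p : Pred X) : IsPure (asrt p) := (isDiamondPositive_asrt p).1

theorem IsDiamondPositive.isDiamondSelfAdjoint {X : C} {f : X ⟶ X} (h : IsDiamondPositive f) :
    IsDiamondSelfAdjoint f := by
  obtain ⟨-, g, hg, rfl⟩ := h
  exact IsDiamondAdjoint.comp hg hg

theorem isDiamondSelfAdjoint_asrt {X : C} (p : Pred X) : IsDiamondSelfAdjoint (asrt p) :=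
  (isDiamondPositive_asrt p).isDiamondSelfAdjoint

theorem im_asrt {X : C} (p : Pred X) : im (asrt p) = ceil p := by
  rw [← (isDiamondSelfAdjoint_asrt p).ceil_comp_truth, asrt_comp_truth]

theorem isDiamondSelfAdjoint_id (X : C) : IsDiamondSelfAdjoint (𝟙 X) := by
  funext s
  apply Subtype.ext
  change ceil (𝟙 X ≫ s.1) = im (compr s.1 ≫ 𝟙 X)
  rw [Category.id_comp, Category.comp_id, s.2.ceil_eq, im_compr s.2]

@[simp]
theorem asrt_truth (X : C) : asrt (truth X) = 𝟙 X :=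
  (IsDiamondPositive.eq_asrt ⟨(isCompr_of_isIso (𝟙 X)).isPure, 𝟙 X, isDiamondSelfAdjoint_id X,
    by simp⟩ (by simp)).symm

/-- A factorization of an assert map through a comprehension of its image has a quotient as first
factor. -/
theorem isQuot_of_comp_isCompr {X Y A : C} {f : X ⟶ Y} (hf : IsPure f) {ζ : X ⟶ A} {π : A ⟶ Y}
    (hπ : IsCompr π) (him : im π = im f) (h : ζ ≫ π = f) : IsQuot ζ := by
  obtain ⟨Z, ξ, ρ, hξ, hρ, rfl⟩ := hf
  have := IsQuot.epi hξ
  have := hπ.mono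
  rw [im_epi_comp] at him
  obtain ⟨α, hα⟩ := IsCompr.exists_iso hρ hπ him.symm
  have : ζ = ξ ≫ α.hom := by rw [← cancel_mono π, h, Category.assoc, hα]
  rw [this]
  exact IsQuot.comp hξ (isQuot_of_isIso _)

/-- Every comprehension of a sharp predicate has a corresponding quotient. -/
theorem exists_isCorresponding {X A : C} {s : Pred X} (hs : IsSharp s) {π : A ⟶ X}
    (hπ : IsComprehension s π) : ∃ ζ : X ⟶ A, IsCorresponding s π ζ := by
  have hc : IsCompr π := ⟨s, hπ⟩
  have := hπ.mono
  have him : im π = s := hπ.im_eq hs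
  have ha : im (asrt s) = s := (im_asrt s).trans hs.ceil_eq
  obtain ⟨ζ, hζ⟩ := hc.exists_fac (asrt s) (by rw [ha, him])
  have hq : IsQuot ζ := isQuot_of_comp_isCompr (isPure_asrt s) hc (by rw [him, ha]) hζ
  have hζt : ζ ≫ truth A = s := by
    rw [← hπ.total, ← Category.assoc, hζ, asrt_comp_truth]
  have := hq.epi
  have hp : IsPure (π ≫ ζ) := IsAndEffectus.isPure_quotient_comprehension π ζ hc hq
  have hθt : (π ≫ ζ) ≫ truth A = truth A := by rw [Category.assoc, hζt, hπ.1, hπ.total]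
  -- The composite is pure and total, hence a comprehension; having image `1`, it is an isomorphism.
  have hθc : IsCompr (π ≫ ζ) := hp.isCompr_of_total hθt
  have hθi : im (π ≫ ζ) = truth A := by
    have h1 : s ≤ ζ ≫ im (π ≫ ζ) := by
      rw [← him, im_le_iff, ← Category.assoc, comp_im, hθt, hπ.total]
    rw [← cancel_epi ζ]
    exact _root_.le_antisymm (comp_le_truth _ _) (hζt ▸ h1)
  obtain ⟨θ, hθ⟩ := hθc.exists_iso (isCompr_of_isIso (𝟙 A))
    (by rw [hθi, im_eq_truth_of_epi])
  rw [Category.comp_id] at hθ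
  have hsq : asrt s ≫ asrt s = (ζ ≫ θ.hom) ≫ π := by rw [hθ, ← hζ]; simp
  have hidem : asrt s ≫ asrt s = asrt s := by
    -- Idempotence comes from uniqueness of asserts. Purity of the square needs the isomorphism `θ`,
    -- because closure of pure maps under composition itself rests on this lemma.
    refine IsDiamondPositive.eq_asrt ⟨?_, _, isDiamondSelfAdjoint_asrt s, rfl⟩ ?_
    · rw [hsq]
      exact ⟨A, _, π, hq.comp (isQuot_of_isIso _), hc, rfl⟩
    · rw [Category.assoc, asrt_comp_truth]
      conv_rhs => rw [← asrt_comp_truth s]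
      rw [← im_le_iff, ha]
  refine ⟨ζ, hπ, isQuotient_iff.2 ⟨by rw [hζt, compl_compl], hq⟩, ?_, hζ⟩
  rw [← hζ, Category.assoc, cancel_epi, ← Category.assoc] at hidem
  rw [← cancel_mono π, hidem, Category.id_comp]

theorem exists_isCorresponding_of_isSharp {X : C} {s : Pred X} (hs : IsSharp s) :
    ∃ (A : C) (π : A ⟶ X) (ζ : X ⟶ A), IsCorresponding s π ζ :=
  ⟨_, compr s, exists_isCorresponding hs (isComprehension_compr s)⟩

section IsCorresponding

variable {X A : C} {s : Pred X} {π : A ⟶ X} {ζ : X ⟶ A}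

theorem IsCorresponding.isCompr (h : IsCorresponding s π ζ) : IsCompr π := ⟨_, h.1⟩

theorem IsCorresponding.isQuot (h : IsCorresponding s π ζ) : IsQuot ζ := ⟨_, h.2.1⟩

theorem IsCorresponding.comp_truth (h : IsCorresponding s π ζ) : ζ ≫ truth A = s := by
  rw [h.2.1.comp_truth, compl_compl]

theorem IsCorresponding.im_eq (h : IsCorresponding s π ζ) : im π = s := by
  refine _root_.le_antisymm h.1.im_le ?_
  have hle := im_comp_le ζ π
  rw [h.2.2.2, im_asrt] at hle
  exact (le_ceil s).trans hle

theorem IsCorresponding.fac (h : IsCorresponding s π ζ) {Y : C} {f : X ⟶ Y}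
    (hf : f ≫ truth Y ≤ s) : ζ ≫ π ≫ f = f := by
  obtain ⟨f', rfl⟩ := h.isQuot.exists_fac f (by rwa [h.comp_truth])
  rw [reassoc_of% h.2.2.1]

theorem IsCorresponding.fac_right (h : IsCorresponding s π ζ) {Y : C} {f : Y ⟶ X}
    (hf : im f ≤ s) : f ≫ ζ ≫ π = f := by
  obtain ⟨f', rfl⟩ := h.isCompr.exists_fac f (by rwa [h.im_eq])
  rw [Category.assoc, reassoc_of% h.2.2.1]

theorem IsCorresponding.isSharp (h : IsCorresponding s π ζ) : IsSharp s := h.im_eq ▸ isSharp_im _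

/-- The splitting `ζ` moves the predicate `p` defining `ρ` to `X`: since `im (π ∘ ρ) ≤ p ∘ ζ`, a map
landing in that image factors through `π` by a map that satisfies `p`. -/
theorem IsCorresponding.isComprehension_comp (h : IsCorresponding s π ζ) {B : C} {ρ : B ⟶ A}
    (hρ : IsCompr ρ) : IsCompr (ρ ≫ π) := by
  obtain ⟨p, hp⟩ := hρ
  refine ⟨im (ρ ≫ π), comp_im _, fun Z g hg => ?_⟩
  have hle : im (ρ ≫ π) ≤ ζ ≫ p := by
    rw [im_le_iff, Category.assoc, reassoc_of% h.2.2.1, Category.assoc, h.1.total, hp.1]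
  have hg' := (im_le_iff g _).2 hg
  obtain ⟨g', rfl⟩ := h.isCompr.exists_fac g (hg'.trans (im_comp_le _ _))
  have hp' := (im_le_iff _ _).1 (hg'.trans hle)
  rw [Category.assoc, reassoc_of% h.2.2.1, Category.assoc, h.1.total] at hp'
  obtain ⟨k, rfl, hk⟩ := hp.2 g' hp'
  have := h.1.mono
  exact ⟨k, by simp, fun y hy => hk y (by simpa [← Category.assoc, cancel_mono] using hy)⟩

end IsCorresponding

theorem IsCompr.comp {X K L : C} {ρ : L ⟶ K} {π : K ⟶ X} (hρ : IsCompr ρ) (hπ : IsCompr π) :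
    IsCompr (ρ ≫ π) := by
  obtain ⟨ζ, hζ⟩ := exists_isCorresponding (isSharp_im π) hπ.isComprehension_im
  exact hζ.isComprehension_comp hρ

/-- The inner comprehension followed by a quotient is rewritten as a quotient followed by a
comprehension; each class is closed under composition. -/
theorem IsPure.comp {X Y Z : C} {f : X ⟶ Y} {g : Y ⟶ Z} (hf : IsPure f) (hg : IsPure g) :
    IsPure (f ≫ g) := by
  obtain ⟨A, ξ, π, hξ, hπ, rfl⟩ := hf
  obtain ⟨B, η, ρ, hη, hρ, rfl⟩ := hg
  obtain ⟨D, χ, σ, hχ, hσ, h⟩ := IsAndEffectus.isPure_quotient_comprehension π η hπ hη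
  exact ⟨D, ξ ≫ χ, σ ≫ ρ, IsQuot.comp hξ hχ, IsCompr.comp hσ hρ, by simp [reassoc_of% h]⟩

variable (C) in
theorem isMultiplicative_pureMaps : (pureMaps C).IsMultiplicative where
  id_mem X := (isCompr_of_isIso (𝟙 X)).isPure
  comp_mem _ _ := IsPure.comp

theorem isDiamondPositive_asrt_sq {X : C} (p : Pred X) : IsDiamondPositive (asrt p ≫ asrt p) :=
  ⟨(isPure_asrt p).comp (isPure_asrt p), _, isDiamondSelfAdjoint_asrt p, rfl⟩

theorem asrt_sq {X : C} (p : Pred X) : asrt p ≫ asrt p = asrt (andthen p p) :=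
  (isDiamondPositive_asrt_sq p).eq_asrt (by rw [Category.assoc, asrt_comp_truth]; rfl)

theorem asrt_injective {X : C} {p q : Pred X} (h : asrt p = asrt q) : p = q := by
  rw [← asrt_comp_truth p, h, asrt_comp_truth]

/-! ### Sharpness of quotients and ◇-adjointness of corresponding pairs. -/

/-- ◇-self-adjointness turns `⌈u ∘ asrt_s⌉` into the image of `asrt_s ∘ π_u`, and `asrt_s` fixes
`π_u` because `u ≤ s`. -/
theorem IsSharp.asrt_comp_of_le {X : C} {s u : Pred X} (hs : IsSharp s) (hu : IsSharp u)
    (h : u ≤ s) : asrt s ≫ u ≤ u := by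
  obtain ⟨A, π, ζ, hc⟩ := exists_isCorresponding_of_isSharp hs
  have e := congrArg Subtype.val (congrFun (isDiamondSelfAdjoint_asrt s) ⟨u, hu⟩)
  change ceil (asrt s ≫ u) = im (compr u ≫ asrt s) at e
  rw [← hc.2.2.2, hc.fac_right (by rwa [im_compr hu]), im_compr hu, hc.2.2.2] at e
  exact (le_ceil _).trans e.le

/-- Pulling back along a quotient is pushing forward along the corresponding comprehension. -/
theorem IsCorresponding.comp_eq_im {X A : C} {s : Pred X} {π : A ⟶ X} {ζ : X ⟶ A}
    (h : IsCorresponding s π ζ) {t : Pred A} (ht : IsSharp t) : ζ ≫ t = im (compr t ≫ π) := by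
  apply _root_.le_antisymm
  · have h1 : t ≤ π ≫ im (compr t ≫ π) := by
      rw [← im_compr ht, im_le_iff, im_compr ht, ← Category.assoc, comp_im, Category.assoc,
        h.1.total]
    refine (comp_le_comp ζ h1).trans ?_
    rw [← Category.assoc, h.2.2.2]
    exact h.isSharp.asrt_comp_of_le (isSharp_im _) ((im_comp_le _ _).trans h.im_eq.le)
  · rw [im_le_iff, Category.assoc, reassoc_of% h.2.2.1, Category.assoc, h.1.total,
      (isComprehension_compr t).1]

theorem IsCorresponding.isDiamondAdjoint {X A : C} {s : Pred X} {π : A ⟶ X} {ζ : X ⟶ A}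
    (h : IsCorresponding s π ζ) : IsDiamondAdjoint ζ π := by
  funext t
  apply Subtype.ext
  change ceil (ζ ≫ t.1) = im (compr t.1 ≫ π)
  rw [h.comp_eq_im t.2, (isSharp_im _).ceil_eq]

theorem IsCorresponding.isSharpMap {X A : C} {s : Pred X} {π : A ⟶ X} {ζ : X ⟶ A}
    (h : IsCorresponding s π ζ) : IsSharpMap ζ :=
  fun _ ht => h.comp_eq_im ht ▸ isSharp_im _

theorem isCorresponding_truth_of_iso {X Y : C} (α : X ≅ Y) :
    IsCorresponding (truth X) α.inv α.hom :=
  ⟨.of_isCompr (isCompr_of_isIso _) (im_eq_truth_of_epi _),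
    isQuotient_iff.2 ⟨by rw [iso_comp_truth, compl_compl], isQuot_of_isIso _⟩, by simp, by simp⟩

/-- Quotients of sharp predicates are sharp maps. -/
theorem IsQuotient.isSharpMap {X Q : C} {s : Pred X} {ξ : X ⟶ Q} (hs : IsSharp s)
    (h : IsQuotient s ξ) : IsSharpMap ξ := by
  obtain ⟨A, π, ζ, hc⟩ := exists_isCorresponding_of_isSharp
    (IsDiamondEffectus.isSharp_compl s hs)
  -- Any quotient of `s` is a corresponding one followed by an isomorphism, and an isomorphism is
  -- itself a corresponding quotient.
  obtain ⟨α, rfl⟩ := hc.isQuot.exists_iso ⟨s, h⟩ (by rw [hc.comp_truth, h.comp_truth])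
  intro t ht
  rw [Category.assoc]
  exact hc.isSharpMap _ ((isCorresponding_truth_of_iso α).isSharpMap _ ht)

theorem IsCorresponding.comp_iso {X A B : C} {s : Pred X} {π : A ⟶ X} {ζ : X ⟶ A}
    (h : IsCorresponding s π ζ) (α : B ≅ A) : IsCorresponding s (α.hom ≫ π) (ζ ≫ α.inv) := by
  have := h.isQuot.epi
  refine ⟨.of_isCompr (h.isCompr.iso_comp _) ?_, isQuotient_iff.2 ⟨?_, h.isQuot.comp
    (isQuot_of_isIso _)⟩, ?_, ?_⟩
  · rw [im_epi_comp, h.im_eq]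
  · rw [Category.assoc, iso_comp_truth, h.comp_truth, compl_compl]
  · rw [Category.assoc, reassoc_of% h.2.2.1, Iso.hom_inv_id]
  · rw [Category.assoc, Iso.inv_hom_id_assoc, h.2.2.2]

/-- Write `asrt r` as `k ∘ k` with `k` ◇-self-adjoint. Then `π ∘ k ∘ ζ` is ◇-self-adjoint, and `ζ ∘
π = id` makes its square the left-hand side. -/
theorem IsCorresponding.comp_asrt_comp {X A : C} {s : Pred X} {π : A ⟶ X} {ζ : X ⟶ A}
    (h : IsCorresponding s π ζ) (r : Pred A) : ζ ≫ asrt r ≫ π = asrt (ζ ≫ r) := by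
  refine IsDiamondPositive.eq_asrt ⟨h.isQuot.isPure.comp ((isPure_asrt r).comp
    h.isCompr.isPure), ?_⟩ (by rw [Category.assoc, Category.assoc, h.1.total, asrt_comp_truth])
  obtain ⟨k, hk, hr⟩ := (isDiamondPositive_asrt r).2
  refine ⟨ζ ≫ k ≫ π, ?_, by simp [hr, reassoc_of% h.2.2.1]⟩
  have := h.isDiamondAdjoint.comp (IsDiamondAdjoint.comp hk h.isDiamondAdjoint.symm)
  rwa [Category.assoc] at this

theorem IsCorresponding.comp_asrt_sq_comp {X A : C} {s : Pred X} {π : A ⟶ X} {ζ : X ⟶ A}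
    (h : IsCorresponding s π ζ) (r : Pred A) :
    ζ ≫ asrt r ≫ asrt r ≫ π = asrt (ζ ≫ r) ≫ asrt (ζ ≫ r) := by
  rw [← h.comp_asrt_comp]
  simp [reassoc_of% h.2.2.1]

/-! ### Polar decomposition -/

/-- A polar decomposition `f = asrt_{1 ∘ f} ≫ ζ ≫ π` of `f`: a corresponding pair `ρ, ζ` for
`⌈1 ∘ f⌉` and a corresponding pair `π, η` for `im f`. -/
structure IsPolar {X Y A : C} (f : X ⟶ Y) (ρ : A ⟶ X) (ζ : X ⟶ A) (π : A ⟶ Y) (η : Y ⟶ A) :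
    Prop where
  left : IsCorresponding (ceil (f ≫ truth Y)) ρ ζ
  right : IsCorresponding (im f) π η
  fac : f = asrt (f ≫ truth Y) ≫ ζ ≫ π

theorem IsCorresponding.asrt_comp_isQuot {X A : C} {p : Pred X} {ρ : A ⟶ X} {ζ : X ⟶ A}
    (h : IsCorresponding (ceil p) ρ ζ) : IsQuot (asrt p ≫ ζ) := by
  refine isQuot_of_comp_isCompr (isPure_asrt p) h.isCompr (by rw [h.im_eq, im_asrt]) ?_
  rw [Category.assoc, h.fac_right (im_asrt p).le]

/-- If `f = π ∘ ξ`, then `ξ` and `ζ₂ ∘ asrt_{1∘f}` are quotients with the same truth value, while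
`π` and `π₁` are comprehensions with the same image. -/
theorem IsPure.exists_iso {X Y A B : C} {f : X ⟶ Y} (hf : IsPure f) {π₁ : A ⟶ Y} {ζ₁ : Y ⟶ A}
    {π₂ : B ⟶ X} {ζ₂ : X ⟶ B} (h₁ : IsCorresponding (im f) π₁ ζ₁)
    (h₂ : IsCorresponding (ceil (f ≫ truth Y)) π₂ ζ₂) :
    ∃ α : B ≅ A, f = asrt (f ≫ truth Y) ≫ ζ₂ ≫ α.hom ≫ π₁ := by
  obtain ⟨Z, ξ, π, hξ, hπ, hf⟩ := hf
  have := IsQuot.epi hξ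
  have ht : f ≫ truth Y = ξ ≫ truth Z := by rw [hf, Category.assoc, IsCompr.total hπ]
  obtain ⟨α, hα⟩ := h₂.asrt_comp_isQuot.exists_iso hξ (by
    rw [← ht, Category.assoc, h₂.comp_truth, ← im_asrt, comp_im, asrt_comp_truth])
  obtain ⟨β, hβ⟩ := IsCompr.exists_iso hπ h₁.isCompr (by rw [h₁.im_eq, hf, im_epi_comp])
  refine ⟨α ≪≫ β, ?_⟩
  conv_lhs => rw [hf, ← hα, ← hβ]
  simp

theorem IsPure.exists_isPolar {X Y : C} {f : X ⟶ Y} (hf : IsPure f) :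
    ∃ (A : C) (ρ : A ⟶ X) (ζ : X ⟶ A) (π : A ⟶ Y) (η : Y ⟶ A), IsPolar f ρ ζ π η := by
  obtain ⟨A, π₁, ζ₁, h₁⟩ := exists_isCorresponding_of_isSharp (isSharp_im f)
  obtain ⟨B, π₂, ζ₂, h₂⟩ := exists_isCorresponding_of_isSharp (isSharp_ceil (f ≫ truth Y))
  obtain ⟨α, hα⟩ := hf.exists_iso h₁ h₂
  exact ⟨B, π₂, ζ₂, α.hom ≫ π₁, ζ₁ ≫ α.inv, h₂, h₁.comp_iso α, hα⟩

/-- The map `g` is the adjoint of `f` in the sense that `g ∘ f = asrt²_{1 ∘ f}` and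
`1 ∘ g ≤ im f`. For pure `f` there is exactly one such map. -/
structure IsPolarAdjoint {X Y : C} (f : X ⟶ Y) (g : Y ⟶ X) : Prop where
  comp_eq : f ≫ g = asrt (f ≫ truth Y) ≫ asrt (f ≫ truth Y)
  comp_truth_le : g ≫ truth X ≤ im f

section IsPolar

variable {X Y A : C} {f : X ⟶ Y} {ρ : A ⟶ X} {ζ : X ⟶ A} {π : A ⟶ Y} {η : Y ⟶ A}

theorem IsPolar.isPolarAdjoint (h : IsPolar f ρ ζ π η) :
    IsPolarAdjoint f (η ≫ ρ ≫ asrt (f ≫ truth Y)) := by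
  constructor
  · conv_lhs => enter [1]; rw [h.fac]
    simp only [Category.assoc, reassoc_of% h.right.2.2.1]
    rw [h.left.fac]
    rw [asrt_comp_truth]
    exact le_ceil _
  · rw [← h.right.comp_truth, Category.assoc]
    exact comp_le_truth _ _

/-- Cancelling the epi `ζ ∘ asrt_{1∘f}` determines `g ∘ π`; the bound `1∘g ≤ im f` recovers `g` as
`g ∘ π ∘ η`. -/
theorem IsPolar.eq_of_isPolarAdjoint (h : IsPolar f ρ ζ π η) {g : Y ⟶ X}
    (hg : IsPolarAdjoint f g) : g = η ≫ ρ ≫ asrt (f ≫ truth Y) := by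
  have he := h.left.asrt_comp_isQuot.epi
  have hc := hg.comp_eq.trans h.isPolarAdjoint.comp_eq.symm
  conv_lhs at hc => enter [1]; rw [h.fac]
  conv_rhs at hc => enter [1]; rw [h.fac]
  simp only [← Category.assoc] at hc
  rw [Category.assoc _ π, Category.assoc _ π, Category.assoc _ (π ≫ η),
    Category.assoc _ (_ ≫ _), Category.assoc (π ≫ η), cancel_epi, h.right.2.2.1,
    Category.id_comp] at hc
  rw [← hc, h.right.fac hg.comp_truth_le]

end IsPolar

theorem IsPolarAdjoint.unique {X Y : C} {f : X ⟶ Y} (hf : IsPure f) {g g' : Y ⟶ X}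
    (hg : IsPolarAdjoint f g) (hg' : IsPolarAdjoint f g') : g = g' := by
  obtain ⟨A, ρ, ζ, π, η, h⟩ := hf.exists_isPolar
  rw [h.eq_of_isPolarAdjoint hg, h.eq_of_isPolarAdjoint hg']

theorem IsPure.exists_isPolarAdjoint {X Y : C} {f : X ⟶ Y} (hf : IsPure f) :
    ∃ g, IsPolarAdjoint f g := by
  obtain ⟨A, ρ, ζ, π, η, h⟩ := hf.exists_isPolar
  exact ⟨_, h.isPolarAdjoint⟩

/-- The polar adjoint of a pure map. -/
noncomputable def polarAdjoint {X Y : C} {f : X ⟶ Y} (hf : IsPure f) : Y ⟶ X :=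
  hf.exists_isPolarAdjoint.choose

theorem isPolarAdjoint_polarAdjoint {X Y : C} {f : X ⟶ Y} (hf : IsPure f) :
    IsPolarAdjoint f (polarAdjoint hf) := hf.exists_isPolarAdjoint.choose_spec

theorem isPolarAdjoint_asrt {X : C} (p : Pred X) : IsPolarAdjoint (asrt p) (asrt p) :=
  ⟨by rw [asrt_comp_truth], by rw [asrt_comp_truth, im_asrt]; exact le_ceil p⟩

theorem IsPolarAdjoint.isPure {X Y : C} {f : X ⟶ Y} {g : Y ⟶ X} (hf : IsPure f)
    (h : IsPolarAdjoint f g) : IsPure g := by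
  obtain ⟨A, ρ, ζ, π, η, hp⟩ := hf.exists_isPolar
  rw [hp.eq_of_isPolarAdjoint h]
  exact hp.right.isQuot.isPure.comp (hp.left.isCompr.isPure.comp (isPure_asrt _))

theorem IsPolarAdjoint.isDiamondAdjoint {X Y : C} {f : X ⟶ Y} {g : Y ⟶ X} (hf : IsPure f)
    (h : IsPolarAdjoint f g) : IsDiamondAdjoint f g := by
  obtain ⟨A, ρ, ζ, π, η, hp⟩ := hf.exists_isPolar
  rw [hp.eq_of_isPolarAdjoint h]
  have := (isDiamondSelfAdjoint_asrt (f ≫ truth Y)).comp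
    (hp.left.isDiamondAdjoint.comp hp.right.isDiamondAdjoint.symm)
  rwa [← hp.fac, Category.assoc] at this

theorem IsPolarAdjoint.isStandardDagger {X Y : C} {f : X ⟶ Y} {g : Y ⟶ X} (hf : IsPure f)
    (h : IsPolarAdjoint f g) : IsStandardDagger f g := by
  refine ⟨exists_isCorresponding_of_isSharp (isSharp_im f),
    exists_isCorresponding_of_isSharp (isSharp_ceil _), fun A B π₁ ζ₁ π₂ ζ₂ h₁ h₂ => ?_⟩
  obtain ⟨α, hα⟩ := hf.exists_iso h₁ h₂
  have hp : IsPolar f π₂ ζ₂ (α.hom ≫ π₁) (ζ₁ ≫ α.inv) := ⟨h₂, h₁.comp_iso α, hα⟩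
  refine ⟨α, ⟨hα, fun β hβ => ?_⟩, by simpa using hp.eq_of_isPolarAdjoint h⟩
  have := h₂.asrt_comp_isQuot.epi
  have := h₁.isCompr.mono
  have e := hα.symm.trans hβ
  simp only [← Category.assoc] at e
  rw [cancel_mono, cancel_epi] at e
  exact Iso.ext e.symm

/-! ### The dagger on pure maps -/

/-- The equation `asrt²_{p & q} = asrt_p ∘ asrt²_q ∘ asrt_p` for all predicates. -/
abbrev AsrtAndthenSq (C : Type u) [Category.{v} C] [HasFiniteCoproducts C] [Effectus C]
    [IsAndEffectus C] : Prop :=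
  ∀ {X : C} (p q : Pred X),
    asrt (andthen p q) ≫ asrt (andthen p q) = asrt p ≫ (asrt q ≫ asrt q) ≫ asrt p

/-- Condition (2) for `p = s`, with `asrt_s` split as `π ∘ ζ` and the outer `ζ` and `π` cancelled.
-/
theorem IsCorresponding.comp_asrt_sq_comp' (hC : AsrtAndthenSq C) {X A : C} {s : Pred X}
    {π : A ⟶ X} {ζ : X ⟶ A} (h : IsCorresponding s π ζ) (q : Pred X) :
    π ≫ asrt q ≫ asrt q ≫ ζ = asrt (π ≫ q) ≫ asrt (π ≫ q) := by
  have e := hC s q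
  have := h.isQuot.epi
  have := h.1.mono
  rw [andthen, ← h.2.2.2, Category.assoc ζ π q, ← h.comp_asrt_sq_comp] at e
  simp only [Category.assoc] at e
  rw [cancel_epi] at e
  rw [← cancel_mono π]
  simpa using e.symm

/-- Condition (2) for arbitrary pure maps: `asrt²_q` is carried across `π`, then `ζ`, then
`asrt_{1∘f}`, one factor of the polar decomposition at a time. -/
theorem IsPolarAdjoint.comp_asrt_sq_comp (hC : AsrtAndthenSq C) {X Y : C} {f : X ⟶ Y}
    {g : Y ⟶ X} (hf : IsPure f) (h : IsPolarAdjoint f g) (q : Pred Y) :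
    f ≫ asrt q ≫ asrt q ≫ g = asrt (f ≫ q) ≫ asrt (f ≫ q) := by
  obtain ⟨A, ρ, ζ, π, η, hp⟩ := hf.exists_isPolar
  rw [hp.eq_of_isPolarAdjoint h]
  generalize ht : f ≫ truth Y = p
  have hfac := hp.fac
  rw [ht] at hfac
  have e₁ := hp.right.comp_asrt_sq_comp' hC q
  have e₂ := hp.left.comp_asrt_sq_comp (π ≫ q)
  have e₃ := hC p (ζ ≫ π ≫ q)
  have hq : andthen p (ζ ≫ π ≫ q) = f ≫ q := by rw [andthen, hfac]; simp
  rw [hq, ← e₂, ← reassoc_of% e₁] at e₃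
  rw [e₃]
  conv_lhs => rw [hfac]
  simp

/-- The same transport for `g = asrt_{1∘f} ∘ ρ ∘ η` computes `asrt²_{1∘g}` as `f ∘ g`; the bound on
truth values is ◇-adjointness evaluated at `1`. -/
theorem IsPolarAdjoint.symm (hC : AsrtAndthenSq C) {X Y : C} {f : X ⟶ Y} {g : Y ⟶ X}
    (hf : IsPure f) (h : IsPolarAdjoint f g) : IsPolarAdjoint g f := by
  have hd := h.isDiamondAdjoint hf
  refine ⟨?_, hd.ceil_comp_truth ▸ le_ceil _⟩
  obtain ⟨A, ρ, ζ, π, η, hp⟩ := hf.exists_isPolar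
  rw [hp.eq_of_isPolarAdjoint h]
  simp only [Category.assoc, asrt_comp_truth]
  rw [← hp.right.comp_asrt_sq_comp, ← reassoc_of% hp.left.comp_asrt_sq_comp' hC, ← hp.fac]

theorem IsPolarAdjoint.comp (hC : AsrtAndthenSq C) {X Y Z : C} {f : X ⟶ Y} {f' : Y ⟶ X}
    {g : Y ⟶ Z} {g' : Z ⟶ Y} (hf : IsPure f) (hg : IsPure g) (h : IsPolarAdjoint f f')
    (h' : IsPolarAdjoint g g') : IsPolarAdjoint (f ≫ g) (g' ≫ f') := by
  constructor
  · rw [Category.assoc, reassoc_of% h'.comp_eq, h.comp_asrt_sq_comp hC hf, Category.assoc]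
  · have hd := ((h.isDiamondAdjoint hf).comp (h'.isDiamondAdjoint hg)).symm
    rw [← hd.ceil_comp_truth]
    exact le_ceil _

section Dagger

variable [(pureMaps C).IsMultiplicative]

/-- The dagger that sends a pure map to its polar adjoint. -/
noncomputable def polarDagger (hC : AsrtAndthenSq C) : DaggerStructure (PureCat C) where
  dag f := ⟨polarAdjoint f.property, (isPolarAdjoint_polarAdjoint f.property).isPure f.property⟩
  dag_comp f g := by
    ext
    exact (isPolarAdjoint_polarAdjoint (f ≫ g).property).unique (f ≫ g).property
      (.comp hC f.property g.property (isPolarAdjoint_polarAdjoint f.property)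
        (isPolarAdjoint_polarAdjoint g.property))
  dag_id X := by
    ext
    refine (isPolarAdjoint_polarAdjoint (𝟙 X : X ⟶ X).property).unique
      (𝟙 X : X ⟶ X).property ?_
    have := isPolarAdjoint_asrt (truth X.obj)
    rwa [asrt_truth] at this
  dag_dag f := by
    ext
    have h := isPolarAdjoint_polarAdjoint f.property
    have hp := h.isPure f.property
    exact (isPolarAdjoint_polarAdjoint hp).unique hp (h.symm hC f.property)

theorem isPolarAdjoint_polarDagger (hC : AsrtAndthenSq C) {X Y : PureCat C} (f : X ⟶ Y) :
    IsPolarAdjoint f.hom ((polarDagger hC).dag f).hom :=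
  isPolarAdjoint_polarAdjoint f.property

theorem SatisfiesDaggerConditions.isEffectusDagger (h : SatisfiesDaggerConditions C) :
    IsEffectusDagger (polarDagger h.asrt_andthen_sq) := by
  set d := polarDagger h.asrt_andthen_sq
  have hd {X Y : PureCat C} (f : X ⟶ Y) : IsPolarAdjoint f.hom (d.dag f).hom :=
    isPolarAdjoint_polarDagger _ f
  have dag_asrt {X : PureCat C} (p : Pred X.obj) : d.dag (pureAsrt p) = pureAsrt p := by
    ext
    exact (hd (pureAsrt p)).unique (isPure_asrt p) (isPolarAdjoint_asrt p)
  -- Polar adjointness makes `g† ∘ g` a squared assert, hence an assert. Conversely, a square root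
  -- from (1) exhibits every assert as positive.
  have pos_iff {X : PureCat C} (f : X ⟶ X) : d.IsPositive f ↔ ∃ p, f = pureAsrt p := by
    constructor
    · rintro ⟨Y, g, rfl⟩
      refine ⟨andthen (g.hom ≫ truth _) (g.hom ≫ truth _), ?_⟩
      ext
      exact (hd g).comp_eq.trans (asrt_sq _)
    · rintro ⟨p, rfl⟩
      obtain ⟨q, hq, -⟩ := h.existsUnique_sqrt p
      refine ⟨X, pureAsrt q, ?_⟩
      rw [dag_asrt]
      ext
      change asrt p = asrt q ≫ asrt q
      rw [asrt_sq, hq]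
  refine ⟨dag_asrt, fun f => (hd f).isDiamondAdjoint f.property, fun {X} f hf => ?_,
    fun {X} f hf => (pos_iff f).2 ⟨f.hom ≫ truth _, ?_⟩⟩
  · obtain ⟨p, rfl⟩ := (pos_iff f).1 hf
    obtain ⟨q, hq, hu⟩ := h.existsUnique_sqrt p
    refine ⟨pureAsrt q, ⟨(pos_iff _).2 ⟨q, rfl⟩, ?_⟩, ?_⟩
    · ext
      change asrt q ≫ asrt q = asrt p
      rw [asrt_sq, hq]
    · rintro g ⟨hg, hgg⟩
      obtain ⟨r, rfl⟩ := (pos_iff g).1 hg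
      have e : asrt r ≫ asrt r = asrt p := congrArg (fun k => k.hom) hgg
      rw [asrt_sq] at e
      rw [hu r (asrt_injective e)]
  · ext
    exact hf.eq_asrt rfl

/-! ### Consequences of the existence of a dagger -/

section

variable {d : DaggerStructure (PureCat C)}

/-- The positive square root `k† ∘ k` is its own dagger, hence ◇-self-adjoint. -/
theorem IsEffectusDagger.isDiamondPositive (hd : IsEffectusDagger d) {X : PureCat C}
    {f : X ⟶ X} (hf : d.IsPositive f) : IsDiamondPositive f.hom := by
  obtain ⟨g, ⟨⟨Y, k, rfl⟩, rfl⟩, -⟩ := hd.existsUnique_sqrt f hf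
  refine ⟨((k ≫ d.dag k) ≫ k ≫ d.dag k).property, (k ≫ d.dag k).hom, ?_, rfl⟩
  have := hd.isDiamondAdjoint (k ≫ d.dag k)
  rwa [d.dag_comp, d.dag_dag] at this

theorem IsEffectusDagger.comp_dag_eq_asrt (hd : IsEffectusDagger d) {X Y : PureCat C}
    (f : X ⟶ Y) : f ≫ d.dag f = pureAsrt ((f ≫ d.dag f).hom ≫ truth _) := by
  ext
  exact (hd.isDiamondPositive ⟨Y, f, rfl⟩).eq_asrt rfl

/-- The dagger of a quotient is its corresponding comprehension. -/
theorem IsEffectusDagger.dag_quotient (hd : IsEffectusDagger d) {X A : PureCat C}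
    {s : Pred X.obj} {π : A ⟶ X} {ζ : X ⟶ A} (h : IsCorresponding s π.hom ζ.hom) :
    d.dag ζ = π := by
  have hπζ : π ≫ ζ = 𝟙 A := by
    ext
    exact h.2.2.1
  have ht : (d.dag ζ).hom ≫ truth X.obj = truth A.obj := by
    refine _root_.le_antisymm (le_truth _) ?_
    -- The dagger of `ζ ∘ π = id` shows that `ζ†` is split mono, hence total.
    have e : d.dag ζ ≫ d.dag π = 𝟙 A := by rw [← d.dag_comp, hπζ, d.dag_id]
    have e' : (d.dag ζ).hom ≫ (d.dag π).hom = 𝟙 A.obj := congrArg (fun k => k.hom) e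
    rw [← Category.id_comp (truth A.obj), ← e', Category.assoc]
    exact comp_le_truth _ _
  have hi : im (d.dag ζ).hom = s := by
    rw [← (hd.isDiamondAdjoint ζ).ceil_comp_truth, h.comp_truth, h.isSharp.ceil_eq]
  have hc := IsPure.isCompr_of_total (d.dag ζ).property ht
  -- This composite is †-positive, hence an assert; its truth value is `1`, so it is the identity.
  have hζζ : d.dag ζ ≫ ζ = 𝟙 A := by
    have h1 := hd.comp_dag_eq_asrt (d.dag ζ)
    rw [d.dag_dag] at h1
    have h2 : (d.dag ζ ≫ ζ).hom ≫ truth _ = truth _ := by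
      change ((d.dag ζ).hom ≫ ζ.hom) ≫ _ = _
      rw [Category.assoc, h.comp_truth, ← hi, comp_im, ht]
    rw [h1, h2]
    ext
    exact asrt_truth _
  ext
  rw [← h.fac_right hi.le, ← Category.assoc]
  change (d.dag ζ ≫ ζ).hom ≫ π.hom = _
  rw [hζζ]
  exact Category.id_comp _

theorem IsEffectusDagger.isPolarAdjoint (hd : IsEffectusDagger d) {X Y : PureCat C}
    (f : X ⟶ Y) : IsPolarAdjoint f.hom (d.dag f).hom := by
  obtain ⟨A, ρ, ζ, π, η, h⟩ := IsPure.exists_isPolar f.property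
  let A' : PureCat C := ⟨A⟩
  let ρ' : A' ⟶ X := ⟨ρ, h.left.isCompr.isPure⟩
  let ζ' : X ⟶ A' := ⟨ζ, h.left.isQuot.isPure⟩
  let π' : A' ⟶ Y := ⟨π, h.right.isCompr.isPure⟩
  let η' : Y ⟶ A' := ⟨η, h.right.isQuot.isPure⟩
  have hζ : d.dag ζ' = ρ' := hd.dag_quotient h.left
  have hη : d.dag η' = π' := hd.dag_quotient h.right
  have hf : f = pureAsrt (f.hom ≫ truth _) ≫ ζ' ≫ π' := by
    ext
    exact h.fac
  have e : d.dag f = η' ≫ ρ' ≫ pureAsrt (f.hom ≫ truth _) := by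
    conv_lhs => rw [hf]
    rw [d.dag_comp, d.dag_comp, hζ, ← hη, d.dag_dag, hd.dag_asrt, Category.assoc]
  rw [e]
  exact h.isPolarAdjoint

theorem IsEffectusDagger.satisfiesDaggerConditions (hd : IsEffectusDagger d) :
    SatisfiesDaggerConditions C where
  existsUnique_sqrt {X} p := by
    let X' : PureCat C := ⟨X⟩
    have hp (q : Pred X) : d.IsPositive (pureAsrt q : X' ⟶ X') :=
      hd.isPositive_of_isDiamondPositive _ (isDiamondPositive_asrt q)
    have hsq (q r : Pred X) : (pureAsrt q ≫ pureAsrt q : X' ⟶ X') = pureAsrt r ↔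
        andthen q q = r := by
      refine ⟨fun h => asrt_injective ?_, fun h => ?_⟩
      · rw [← asrt_sq]
        exact congrArg (fun k => k.hom) h
      · ext
        change asrt q ≫ asrt q = asrt r
        rw [asrt_sq, h]
    obtain ⟨g, ⟨hg, hgg⟩, hu⟩ := hd.existsUnique_sqrt (pureAsrt p : X' ⟶ X') (hp p)
    obtain ⟨q, rfl⟩ : ∃ q : Pred X, g = (pureAsrt q : X' ⟶ X') := by
      refine ⟨g.hom ≫ truth X, ?_⟩
      ext
      exact (hd.isDiamondPositive hg).eq_asrt rfl
    refine ⟨q, (hsq q p).1 hgg, fun r hr => asrt_injective ?_⟩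
    exact congrArg (fun k => k.hom) (hu _ ⟨hp r, (hsq r p).2 hr⟩)
  asrt_andthen_sq {X} p q := by
    let X' : PureCat C := ⟨X⟩
    -- For this `f` the dagger reverses the two asserts, so `f† ∘ f = asrt²_{1∘f}` is condition (2).
    let f : X' ⟶ X' := pureAsrt p ≫ pureAsrt q
    have hf : f.hom ≫ truth X = andthen p q := by
      change (asrt p ≫ asrt q) ≫ _ = _
      rw [Category.assoc, asrt_comp_truth]
      rfl
    have e := (hd.isPolarAdjoint f).comp_eq
    rw [d.dag_comp, hd.dag_asrt, hd.dag_asrt] at e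
    rw [← hf]
    refine e.symm.trans ?_
    change (asrt p ≫ asrt q) ≫ asrt q ≫ asrt p = _
    simp
  isSharpMap_quotient _ _ hs h := h.isSharpMap hs

end

end Dagger

end And

end Effectus

theorem mainTheorem1 (C : Type u) [Category.{v} C] [HasFiniteCoproducts C] [Effectus C]
    [Effectus.IsAndEffectus C] :
    ∃ _ : (Effectus.pureMaps C).IsMultiplicative,
      (Effectus.IsDaggerEffectus C ↔ Effectus.SatisfiesDaggerConditions C) ∧
      (Effectus.SatisfiesDaggerConditions C →
        ∃ d : DaggerStructure (Effectus.PureCat C), Effectus.IsEffectusDagger d ∧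
          ∀ {X Y : Effectus.PureCat C} (f : X ⟶ Y),
            Effectus.IsStandardDagger f.hom (d.dag f).hom) := by
  have hm := Effectus.isMultiplicative_pureMaps C
  refine ⟨hm, ⟨fun ⟨_, hd⟩ => hd.satisfiesDaggerConditions, fun h => ⟨_, h.isEffectusDagger⟩⟩,
    fun h => ⟨_, h.isEffectusDagger, fun f => ?_⟩⟩
  exact (Effectus.isPolarAdjoint_polarDagger _ f).isStandardDagger f.property
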